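/- Fix a first-order language with at least one constant symbol; all programs and queries are over it, and "ground" means: instantiated by ground terms of this language. A (general) program is a finite set of clauses $H\leftarrow L_1,\dots,L_n$ with $H$ an atom and the $L_i$ literals; a query is a finite sequence of literals. Queries are executed by LDNF-resolution: the leftmost literal is selected; a positive one is resolved with a program clause by a most general unifier; for a negative ground literal $\neg A$ a subsidiary LDNF-tree for $A$ is built, and $\neg A$ succeeds if that tree is finitely failed and fails if that tree has a success leaf; a query whose first literal is negative and non-ground flounders (the derivation stops). A derivation also counts as infinite if the construction of one of its subsidiary trees diverges. Fix a moding, that is, a function marking each argument position of each relation symbol as input ($+$) or output ($-$). Write $p(\mathbf s,\mathbf t)$ for a positive or negative literal with input terms $\mathbf s$ and output terms $\mathbf t$. A query $p_1(\mathbf s_1,\mathbf t_1),\dots,p_n(\mathbf s_n,\mathbf t_n)$ is well-moded if $\mathrm{Var}(\mathbf s_i)\subseteq\bigcup_{j=1}^{i-1}\mathrm{Var}(\mathbf t_j)$ for $1\le i\le n$. A clause $p(\mathbf t_0,\mathbf s_{n+1})\leftarrow p_1(\mathbf s_1,\mathbf t_1),\dots,p_n(\mathbf s_n,\mathbf t_n)$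 (input terms $\mathbf t_0$ and output terms $\mathbf s_{n+1}$ in the head) is well-moded if $\mathrm{Var}(\mathbf s_i)\subseteq\bigcup_{j=0}^{i-1}\mathrm{Var}(\mathbf t_j)$ for $1\le i\le n+1$. A program is well-moded if all its clauses are. For a program $S$, let $\mathrm{Neg}^*_S$ be the set of relations on which (in the reflexive, transitive sense) the relations occurring in negative literals of clauses of $S$ depend, and let $S^-$ be the set of clauses of $S$ defining a relation in $\mathrm{Neg}^*_S$. A model $M$ of $S$ is complete if its restriction to the relations in $\mathrm{Neg}^*_S$ is a model of Clark's completion $\mathrm{comp}(S^-)$: it satisfies the completed definition of each of these relations (a relation without clauses is empty) and, if $S^-\neq\emptyset$, Clark's free equality axioms for the language (which every Herbrand interpretation satisfies). A level mapping for $P$ assigns a natural number $|A|$ to each ground atom $A$ whose relation occurs in $P$, with $|\neg A|=|A|$; it is moded if $|p(\mathbf s,\mathbf t)|=|p(\mathbf s,\mathbf u)|$ always. $P$ is acceptable with respect to $|\ |$ and $M$ if for every ground instance $A\leftarrow\mathbf A,B,\mathbf B$ of a clause of $P$: if $M\models\mathbf A$ then $|A|>|B|$. Statement. Let $P$ and $R$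 be programs such that $P\cup R$ is well-moded and $P$ extends $R$ (no relation occurring in the head of a clause of $P$ occurs in $R$), and let $M$ be a complete model of $P\cup R$. Suppose that (i) $P$ is acceptable with respect to a moded level mapping $|\ |$ for $P$ and $M$; (ii) for all well-moded queries $Q$, all LDNF-derivations of $R\cup\{Q\}$ are finite. Then for all well-moded queries $Q$, all LDNF-derivations of $(P\cup R)\cup\{Q\}$ are finite. -/

import Mathlib

universe u v w

/-! Syntax of general logic programs over a first-order language `L`, LDNF-resolution,
models of the completion, acceptability, and well-modedness. -/

namespace LogicProg

/-! ### Syntax -/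

/-- Relation (predicate) symbols of `L`, of any arity. -/
abbrev RelSym (L : FirstOrder.Language.{u, v}) : Type v := Σ n : ℕ, L.Relations n

/-- Atoms `p(t₁,…,tₙ)` with variables in `α`. Variables are natural numbers in programs and
queries; `Atom L Empty` is the type of ground atoms. -/
structure Atom (L : FirstOrder.Language.{u, v}) (α : Type) where
  arity : ℕ
  rel : L.Relations arity
  args : Fin arity → L.Term α

/-- Literals: atoms and negations of atoms. -/
inductive Literal (L : FirstOrder.Language.{u, v}) (α : Type) where
  | pos (A : Atom L α)
  | neg (A : Atom L α)

/-- A general clause `head ← body`. -/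
structure Clause (L : FirstOrder.Language.{u, v}) (α : Type) where
  head : Atom L α
  body : List (Literal L α)

/-- A general query: a possibly empty finite sequence of literals. -/
abbrev Query (L : FirstOrder.Language.{u, v}) : Type (max u v) := List (Literal L ℕ)

/-- A set of general clauses. General programs are the finite ones; finiteness is a hypothesis
`P.Finite` where programs are quantified over. -/
abbrev Program (L : FirstOrder.Language.{u, v}) : Type (max u v) := Set (Clause L ℕ)

section Basics

variable {L : FirstOrder.Language.{u, v}} {α β : Type}

/-- The relation symbol of an atom. -/
def Atom.sym (A : Atom L α) : RelSym L := ⟨A.arity, A.rel⟩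

/-- Application of a substitution to an atom. -/
def Atom.subst (A : Atom L α) (σ : α → L.Term β) : Atom L β :=
  ⟨A.arity, A.rel, fun i => (A.args i).subst σ⟩

/-- The variables of a term. -/
def termVars (t : L.Term ℕ) : Set ℕ := ↑t.varFinset

/-- The variables of an atom. -/
def Atom.vars (A : Atom L ℕ) : Set ℕ := {x | ∃ i, x ∈ termVars (A.args i)}

/-- An atom is ground if it contains no variable. -/
def Atom.IsGround (A : Atom L ℕ) : Prop := A.vars = ∅

/-- The atom underlying a literal. -/
def Literal.atom : Literal L α → Atom L α
  | .pos A => A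
  | .neg A => A

/-- The relation symbol of a literal. -/
def Literal.sym (l : Literal L α) : RelSym L := l.atom.sym

/-- Application of a substitution to a literal. -/
def Literal.subst : Literal L α → (α → L.Term β) → Literal L β
  | .pos A, σ => .pos (A.subst σ)
  | .neg A, σ => .neg (A.subst σ)

/-- The variables of a literal. -/
def Literal.vars (l : Literal L ℕ) : Set ℕ := l.atom.vars

/-- Application of a substitution to a clause. -/
def Clause.subst (c : Clause L α) (σ : α → L.Term β) : Clause L β :=
  ⟨c.head.subst σ, c.body.map fun l => l.subst σ⟩

/-- Application of a substitution to a query. -/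
def Query.subst (Q : Query L) (σ : ℕ → L.Term ℕ) : Query L := Q.map fun l => l.subst σ

/-- The variables of a query. -/
def Query.vars (Q : Query L) : Set ℕ := {x | ∃ l ∈ Q, x ∈ l.vars}

/-- The variables of a clause. -/
def Clause.vars (c : Clause L ℕ) : Set ℕ := c.head.vars ∪ Query.vars c.body

/-- `c'` is a variant of `c`: it arises by renaming the variables. -/
def Clause.IsVariant (c' c : Clause L ℕ) : Prop :=
  ∃ ρ : Equiv.Perm ℕ, c' = c.subst fun x => FirstOrder.Language.Term.var (ρ x)

/-- `σ` is a most general unifier of the atoms `A` and `B`. -/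
def IsMGU (σ : ℕ → L.Term ℕ) (A B : Atom L ℕ) : Prop :=
  A.subst σ = B.subst σ ∧
    ∀ τ : ℕ → L.Term ℕ, A.subst τ = B.subst τ →
      ∃ η : ℕ → L.Term ℕ, ∀ x, τ x = (σ x).subst η

/-- The set of all ground instances of clauses of `P`, over the ground terms of `L`. -/
def ground (P : Program L) : Set (Clause L Empty) :=
  {g | ∃ c ∈ P, ∃ σ : ℕ → L.Term Empty, g = c.subst σ}

end Basics

/-! ### LDNF-resolution -/

section LDNF

variable {L : FirstOrder.Language.{u, v}}

/-- `Resolvent P Q Q'`: the first literal of `Q` is positive, and `Q'` is obtained from `Q` by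
resolving it with a variant of a clause of `P` that has no variable in common with `Q`. -/
inductive Resolvent (P : Program L) : Query L → Query L → Prop
  | intro (A : Atom L ℕ) (B : Query L) (c c' : Clause L ℕ) (σ : ℕ → L.Term ℕ)
      (hc : c ∈ P) (hvar : c'.IsVariant c)
      (hdisj : Disjoint c'.vars (Query.vars (Literal.pos A :: B)))
      (hmgu : IsMGU σ A c'.head) :
      Resolvent P (Literal.pos A :: B) (Query.subst (c'.body ++ B) σ)

mutual

/-- The LDNF-tree of `P ∪ {Q}` has a success leaf (an empty query). -/
inductive Successful (P : Program L) : Query L → Prop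
  | nil : Successful P []
  | resolve (Q Q' : Query L) (hres : Resolvent P Q Q') (hQ : Successful P Q') :
      Successful P Q
  | naf (A : Atom L ℕ) (B : Query L) (hA : A.IsGround)
      (hfail : FinitelyFailed P [Literal.pos A]) (hB : Successful P B) :
      Successful P (Literal.neg A :: B)

/-- The LDNF-tree of `P ∪ {Q}` is finitely failed: it is finite and all its leaves are failed.
A query whose first literal is positive and which has no resolvent is a failed leaf; so is
`¬A, B` for a ground `A` whose subsidiary tree is successful. If the subsidiary tree is finitely
failed, the only child of `¬A, B` is `B`. A query that flounders is a leaf, but not a failed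
one. -/
inductive FinitelyFailed (P : Program L) : Query L → Prop
  | resolve (A : Atom L ℕ) (B : Query L)
      (hall : ∀ Q', Resolvent P (Literal.pos A :: B) Q' → FinitelyFailed P Q') :
      FinitelyFailed P (Literal.pos A :: B)
  | negSuccess (A : Atom L ℕ) (B : Query L) (hA : A.IsGround)
      (hsucc : Successful P [Literal.pos A]) :
      FinitelyFailed P (Literal.neg A :: B)
  | negFail (A : Atom L ℕ) (B : Query L) (hA : A.IsGround)
      (hfail : FinitelyFailed P [Literal.pos A]) (hB : FinitelyFailed P B) :
      FinitelyFailed P (Literal.neg A :: B)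

end

/-- `DerivationStep P Q Q'`: `Q'` is a child of `Q` in an LDNF-tree. -/
inductive DerivationStep (P : Program L) : Query L → Query L → Prop
  | resolve (Q Q' : Query L) (hres : Resolvent P Q Q') : DerivationStep P Q Q'
  | naf (A : Atom L ℕ) (B : Query L) (hA : A.IsGround)
      (hfail : FinitelyFailed P [Literal.pos A]) :
      DerivationStep P (Literal.neg A :: B) B

/-- `SubsidiaryCall Q Q'`: at the query `Q` a subsidiary LDNF-tree with root `Q'` is built. -/
inductive SubsidiaryCall : Query L → Query L → Prop
  | intro (A : Atom L ℕ) (B : Query L) (hA : A.IsGround) :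
      SubsidiaryCall (Literal.neg A :: B) [Literal.pos A]

/-- The interpreter diverges on `P ∪ {Q}`: there is an infinite sequence of queries starting
with `Q`, each followed by one of its children in the LDNF-tree or by the root of the
subsidiary LDNF-tree that it calls. Thus a derivation counts as infinite also when the
construction of one of its subsidiary trees diverges (possibly by an infinite nesting of
subsidiary trees). -/
def Diverges (P : Program L) (Q : Query L) : Prop :=
  ∃ f : ℕ → Query L, f 0 = Q ∧
    ∀ n, DerivationStep P (f n) (f (n + 1)) ∨ SubsidiaryCall (f n) (f (n + 1))

/-- All LDNF-derivations of `P ∪ {Q}` are finite. -/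
def AllDerivationsFinite (P : Program L) (Q : Query L) : Prop := ¬ Diverges P Q

end LDNF

/-! ### Dependency of relations, extension -/

section Dependency

variable {L : FirstOrder.Language.{u, v}}

/-- `p` refers to `q` in `P`. -/
def RefersTo (P : Program L) (p q : RelSym L) : Prop :=
  ∃ c ∈ P, c.head.sym = p ∧ ∃ l ∈ c.body, l.sym = q

/-- `p` depends on `q` in `P`. -/
def DependsOn (P : Program L) : RelSym L → RelSym L → Prop :=
  Relation.ReflTransGen (RefersTo P)

/-- The relations occurring in a negative literal in a clause of `P`. -/
def negRels (P : Program L) : Set (RelSym L) :=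
  {q | ∃ c ∈ P, ∃ A : Atom L ℕ, Literal.neg A ∈ c.body ∧ A.sym = q}

/-- The relations on which the relations in `negRels P` depend. -/
def negStar (P : Program L) : Set (RelSym L) :=
  {q | ∃ p ∈ negRels P, DependsOn P p q}

/-- `P⁻`: the clauses of `P` defining a relation of `negStar P`. -/
def minusPart (P : Program L) : Program L := {c ∈ P | c.head.sym ∈ negStar P}

/-- The relation `p` is defined in `P`. -/
def DefinedIn (p : RelSym L) (P : Program L) : Prop := ∃ c ∈ P, c.head.sym = p

/-- The relation `p` occurs in `P`. -/
def OccursIn (p : RelSym L) (P : Program L) : Prop :=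
  ∃ c ∈ P, c.head.sym = p ∨ ∃ l ∈ c.body, l.sym = p

/-- `P` extends `R`: no relation defined in `P` occurs in `R`. -/
def Extends (P R : Program L) : Prop := ∀ p, DefinedIn p P → ¬ OccursIn p R

end Dependency

/-! ### Models. Interpretations are arbitrary first-order structures, given as explicit
arguments; equality is interpreted as identity. -/

section Models

variable {L : FirstOrder.Language.{u, v}} {D : Type w} {α : Type}

/-- The value of a term in the interpretation `M` under the assignment `v`. -/
def termValue (M : L.Structure D) (v : α → D) (t : L.Term α) : D :=
  letI := M
  t.realize v

/-- Truth of an atom in `M` under `v`. -/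
def Atom.Holds (M : L.Structure D) (v : α → D) (A : Atom L α) : Prop :=
  M.RelMap A.rel fun i => termValue M v (A.args i)

/-- Truth of a literal in `M` under `v`. -/
def Literal.Holds (M : L.Structure D) (v : α → D) : Literal L α → Prop
  | .pos A => A.Holds M v
  | .neg A => ¬ A.Holds M v

/-- `M` is a model of the program `P`. -/
def IsModel (M : L.Structure D) (P : Program L) : Prop :=
  ∀ c ∈ P, ∀ v : ℕ → D, (∀ l ∈ c.body, l.Holds M v) → c.head.Holds M v

/-- The restriction of `M` to the relations in `S`: all other relations become empty. -/
@[reducible] def restrict (M : L.Structure D) (S : Set (RelSym L)) : L.Structure D where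
  funMap := M.funMap
  RelMap := fun {n} p d => (⟨n, p⟩ : RelSym L) ∈ S ∧ M.RelMap p d

/-- `M` satisfies Clark's free equality axioms for the function symbols of `L`. -/
structure FreeEquality (M : L.Structure D) : Prop where
  injective : ∀ (n : ℕ) (f : L.Functions n) (d e : Fin n → D),
    M.funMap f d = M.funMap f e → d = e
  distinct : ∀ (n k : ℕ) (f : L.Functions n) (g : L.Functions k) (d : Fin n → D) (e : Fin k → D),
    (⟨n, f⟩ : Σ n, L.Functions n) ≠ ⟨k, g⟩ → M.funMap f d ≠ M.funMap g e
  acyclic : ∀ (x : ℕ) (t : L.Term ℕ), x ∈ termVars t → t ≠ FirstOrder.Language.Term.var x →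
    ∀ v : ℕ → D, termValue M v t ≠ v x

/-- `M` satisfies the completed definition in `P` of every relation symbol `p`, that is
`∀ x̄ (p(x̄) ↔ ⋁ ∃ ȳ (x̄ = t̄ ∧ L₁ ∧ … ∧ Lₖ))`, the disjunction being over the clauses
`p(t̄) ← L₁,…,Lₖ` of `P`, with `ȳ` the variables of the clause. If there is no such clause, this
says that `p` is empty. -/
def SatisfiesCompletedDefs (M : L.Structure D) (P : Program L) : Prop :=
  ∀ (n : ℕ) (p : L.Relations n) (d : Fin n → D),
    M.RelMap p d ↔
      ∃ (t : Fin n → L.Term ℕ) (body : List (Literal L ℕ)),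
        (⟨⟨n, p, t⟩, body⟩ : Clause L ℕ) ∈ P ∧
        ∃ v : ℕ → D, (∀ i, d i = termValue M v (t i)) ∧ ∀ l ∈ body, l.Holds M v

/-- `M` is a model of the completion `comp(P)`. The completion of the empty program contains no
equations, and no equality axioms are imposed for it (so that every model of a program without
negative literals is a complete model of it). -/
def IsModelOfCompletion (M : L.Structure D) (P : Program L) : Prop :=
  SatisfiesCompletedDefs M P ∧ (P.Nonempty → FreeEquality M)

/-- `M` is a complete model of `P`. -/
def IsCompleteModel (M : L.Structure D) (P : Program L) : Prop :=
  IsModel M P ∧ IsModelOfCompletion (restrict M (negStar P)) (minusPart P)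

end Models

/-! ### Level mappings and acceptability -/

section Levels

variable {L : FirstOrder.Language.{u, v}} {D : Type w}

/-- Level mappings. A level mapping for a program is used only on ground atoms whose relation
occurs in the program; its values elsewhere are irrelevant. -/
abbrev LevelMapping (L : FirstOrder.Language.{u, v}) : Type (max u v) := Atom L Empty → ℕ

/-- The level of a ground literal: `|¬A| = |A|`. -/
def LevelMapping.ofLiteral (lev : LevelMapping L) (l : Literal L Empty) : ℕ := lev l.atom

/-- `P` is acceptable with respect to the level mapping `lev` and the interpretation `M`: for
every `A ← 𝐀, B, 𝐁` in `ground(P)`, if `M ⊨ 𝐀` then `|A| > |B|`. -/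
def Acceptable (P : Program L) (lev : LevelMapping L) (M : L.Structure D) : Prop :=
  ∀ g ∈ ground P, ∀ (pre : List (Literal L Empty)) (b : Literal L Empty)
    (post : List (Literal L Empty)), g.body = pre ++ b :: post →
    (∀ l ∈ pre, l.Holds M Empty.elim) → lev g.head > lev.ofLiteral b

end Levels

/-! ### Modes -/

/-- Input (`+`) and output (`-`) positions. -/
inductive Mode where
  | input
  | output

/-- A moding: one mode for each relation symbol of `L`. -/
abbrev Moding (L : FirstOrder.Language.{u, v}) : Type v := ∀ n : ℕ, L.Relations n → Fin n → Mode

section Modes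

variable {L : FirstOrder.Language.{u, v}}

/-- The variables in the input positions of an atom. -/
def Atom.inVars (m : Moding L) (A : Atom L ℕ) : Set ℕ :=
  {x | ∃ i, m A.arity A.rel i = Mode.input ∧ x ∈ termVars (A.args i)}

/-- The variables in the output positions of an atom. -/
def Atom.outVars (m : Moding L) (A : Atom L ℕ) : Set ℕ :=
  {x | ∃ i, m A.arity A.rel i = Mode.output ∧ x ∈ termVars (A.args i)}

/-- The variables in the output positions of the literals of a sequence. -/
def seqOutVars (m : Moding L) (Q : List (Literal L ℕ)) : Set ℕ :=
  {x | ∃ l ∈ Q, x ∈ l.atom.outVars m}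

/-- Well-moded queries: the variables in the input positions of each literal occur in output
positions of earlier literals. -/
def WellModedQuery (m : Moding L) (Q : Query L) : Prop :=
  ∀ (pre : Query L) (l : Literal L ℕ) (post : Query L), Q = pre ++ l :: post →
    l.atom.inVars m ⊆ seqOutVars m pre

/-- Well-moded clauses. -/
def WellModedClause (m : Moding L) (c : Clause L ℕ) : Prop :=
  (∀ (pre : Query L) (l : Literal L ℕ) (post : Query L), c.body = pre ++ l :: post →
    l.atom.inVars m ⊆ c.head.inVars m ∪ seqOutVars m pre) ∧
  c.head.outVars m ⊆ c.head.inVars m ∪ seqOutVars m c.body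

/-- Well-moded programs. -/
def WellModedProgram (m : Moding L) (P : Program L) : Prop := ∀ c ∈ P, WellModedClause m c

/-- `lev` is a moded level mapping for `P`: on ground atoms whose relation occurs in `P`, the
level does not depend on the terms in the output positions. -/
def IsModedLevelMapping (m : Moding L) (P : Program L) (lev : LevelMapping L) : Prop :=
  ∀ (n : ℕ) (p : L.Relations n) (s t : Fin n → L.Term Empty), OccursIn ⟨n, p⟩ P →
    (∀ i, m n p i = Mode.input → s i = t i) → lev ⟨n, p, s⟩ = lev ⟨n, p, t⟩

end Modes

end LogicProg

namespace LogicProg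

/-! ### Terms and substitutions -/

section Terms

open FirstOrder.Language

variable {L : FirstOrder.Language.{u, v}} {D : Type w} {α β γ : Type}

-- Finiteness of all derivations is accessibility under `Next`, which relates a query to its
-- children and to the subsidiary query it calls. The first literal of a well-moded query has ground
-- input terms, so a moded level mapping gives it one and the same level in all ground instances.
-- Induction on a bound for this level shows that each well-moded literal whose relation occurs in
-- `P` terminates (`acc_of_level_lt`). If the relation is not defined in `P`, the computation never
-- leaves `R`, and termination of `R` applies (`acc_union_of_acc`). If it is defined in `P`, the
-- literal resolves to an instance of a body from `P`, and acceptability lowers the level of each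
-- body literal, provided that the literals before it are true in `M`.
--
-- This proviso is the heart of the matter. `acc_append` splits a run of `Q₁, Q₂` into a run of `Q₁`
-- followed by an instance of `Q₂`, controlled by an invariant. The invariant used is
-- `BoundedAfter`: truth of what remains of `Q₁` implies the level bound for `Q₂`. Resolution
-- preserves it because `M` is a model. Removing `¬A` after the finite failure of `A` preserves it
-- because `A` is then false in `M` (`FinitelyFailed.not_holds`). That soundness result rests on the
-- completion: a query that is true under some assignment has a resolvent that is again true under
-- some assignment (`exists_resolvent_holds`), since equations solvable in a model of the free
-- equality axioms are unifiable (`exists_isCompatibleMGU`). Calls to `R` run inside `Q₁`, so they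
-- need no level.
--
-- Once single literals terminate, an arbitrary well-moded query is run literal by literal, with
-- well-modedness as the invariant.

theorem mem_termVars_var {x y : ℕ} : x ∈ termVars (Term.var y : L.Term ℕ) ↔ x = y := by
  simp [termVars, Term.varFinset]

theorem mem_termVars_func {n : ℕ} {f : L.Functions n} {ts : Fin n → L.Term ℕ} {x : ℕ} :
    x ∈ termVars (Term.func f ts) ↔ ∃ i, x ∈ termVars (ts i) := by
  simp [termVars, Term.varFinset]

theorem subst_subst (t : L.Term α) (σ : α → L.Term β) (τ : β → L.Term γ) :
    (t.subst σ).subst τ = t.subst fun x => (σ x).subst τ := by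
  induction t with
  | var => rfl
  | func f ts ih => simp only [Term.subst, ih]

theorem subst_congr (t : L.Term ℕ) {σ τ : ℕ → L.Term β} (h : ∀ x ∈ termVars t, σ x = τ x) :
    t.subst σ = t.subst τ := by
  induction t with
  | var x => exact h x (mem_termVars_var.2 rfl)
  | func f ts ih =>
    simp only [Term.subst]
    congr 1
    funext i
    exact ih i fun x hx => h x (mem_termVars_func.2 ⟨i, hx⟩)

theorem mem_termVars_subst {t : L.Term ℕ} {σ : ℕ → L.Term ℕ} {y : ℕ} :
    y ∈ termVars (t.subst σ) ↔ ∃ x ∈ termVars t, y ∈ termVars (σ x) := by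
  induction t with
  | var x => simp [Term.subst, mem_termVars_var]
  | func f ts ih =>
    simp only [Term.subst, mem_termVars_func, ih]
    constructor
    · rintro ⟨i, x, hx, hy⟩
      exact ⟨x, ⟨i, hx⟩, hy⟩
    · rintro ⟨x, ⟨i, hx⟩, hy⟩
      exact ⟨i, x, hx, hy⟩

theorem termValue_func (M : L.Structure D) (v : α → D) {n : ℕ} (f : L.Functions n)
    (ts : Fin n → L.Term α) :
    termValue M v (Term.func f ts) = M.funMap f fun i => termValue M v (ts i) := rfl

theorem termValue_subst (M : L.Structure D) (v : β → D) (t : L.Term α) (σ : α → L.Term β) :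
    termValue M v (t.subst σ) = termValue M (fun x => termValue M v (σ x)) t :=
  letI := M
  Term.realize_subst

theorem termValue_congr (M : L.Structure D) (t : L.Term ℕ) {v v' : ℕ → D}
    (h : ∀ x ∈ termVars t, v x = v' x) : termValue M v t = termValue M v' t := by
  induction t with
  | var x => exact h x (mem_termVars_var.2 rfl)
  | func f ts ih =>
    simp only [termValue_func]
    congr 1
    funext i
    exact ih i fun x hx => h x (mem_termVars_func.2 ⟨i, hx⟩)

theorem termValue_restrict (M : L.Structure D) (S : Set (RelSym L)) (v : α → D) (t : L.Term α) :
    termValue (restrict M S) v t = termValue M v t := by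
  induction t with
  | var x => rfl
  | func f ts ih =>
    simp only [termValue_func, ih]
    rfl

end Terms

/-! ### Unification -/

section Unification

open FirstOrder.Language

variable {L : FirstOrder.Language.{u, v}} {D : Type w}

/-- The number of symbols of a term. -/
def termSize : L.Term ℕ → ℕ
  | .var _ => 1
  | .func _ ts => 1 + ∑ i, termSize (ts i)

/-- The number of symbols of a list of equations. -/
def equationsSize (E : List (L.Term ℕ × L.Term ℕ)) : ℕ :=
  (E.map fun e => termSize e.1 + termSize e.2).sum

/-- `σ` unifies all the equations of `E`. -/
def Unifies (σ : ℕ → L.Term ℕ) (E : List (L.Term ℕ × L.Term ℕ)) : Prop :=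
  ∀ e ∈ E, e.1.subst σ = e.2.subst σ

/-- The equations of `E` are true in `M` under `w`. -/
def EquationsHold (M : L.Structure D) (w : ℕ → D) (E : List (L.Term ℕ × L.Term ℕ)) : Prop :=
  ∀ e ∈ E, termValue M w e.1 = termValue M w e.2

/-- `σ` is an idempotent most general unifier of `E` that is compatible with the assignment `w`
in `M`. -/
structure IsCompatibleMGU (M : L.Structure D) (w : ℕ → D) (E : List (L.Term ℕ × L.Term ℕ))
    (σ : ℕ → L.Term ℕ) : Prop where
  unifies : Unifies σ E
  general : ∀ τ, Unifies τ E → ∀ x, τ x = (σ x).subst τ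
  value : ∀ x, w x = termValue M w (σ x)

/-- Variable elimination: any unifier of `x = t` absorbs the substitution `x ↦ t`, and so does any
assignment satisfying `x = t`. Hence generality and compatibility pass from the reduced system to
the original one. -/
theorem IsCompatibleMGU.eliminate {M : L.Structure D} {w : ℕ → D} {x : ℕ} {t : L.Term ℕ}
    (hx : x ∉ termVars t) {E : List (L.Term ℕ × L.Term ℕ)} {σ : ℕ → L.Term ℕ}
    (hw : w x = termValue M w t)
    (hσ : IsCompatibleMGU M w (E.map fun e =>
      (e.1.subst (Function.update Term.var x t), e.2.subst (Function.update Term.var x t))) σ) :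
    IsCompatibleMGU M w ((Term.var x, t) :: E)
      (fun y => (Function.update Term.var x t y : L.Term ℕ).subst σ) := by
  have ht : ∀ {β : Type} (τ : ℕ → L.Term β),
      t.subst (fun y => (Function.update Term.var x t y : L.Term ℕ).subst τ) = t.subst τ := by
    intro β τ
    refine subst_congr t fun y hy => ?_
    rw [Function.update_of_ne (by rintro rfl; exact hx hy)]
    rfl
  refine ⟨?_, ?_, ?_⟩
  · intro e he
    rcases List.mem_cons.1 he with rfl | he
    · simp only [ht]
      simp [Term.subst]
    · have := hσ.unifies _ (List.mem_map.2 ⟨e, he, rfl⟩)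
      simpa only [subst_subst] using this
  · intro τ hτ
    have h1 : ∀ y, (Function.update Term.var x t y : L.Term ℕ).subst τ = τ y := by
      intro y
      by_cases hy : y = x
      · subst hy
        rw [Function.update_self]
        exact (hτ (Term.var y, t) List.mem_cons_self).symm
      · rw [Function.update_of_ne hy]
        rfl
    have h2 := hσ.general τ (by
      intro e he
      obtain ⟨e, he', rfl⟩ := List.mem_map.1 he
      simp only [subst_subst, h1]
      exact hτ e (List.mem_cons_of_mem _ he'))
    intro y
    rw [subst_subst, ← funext h2, h1]
  · intro y
    have h3 : (fun z => termValue M w (σ z)) = w := funext fun z => (hσ.value z).symm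
    rw [termValue_subst, h3]
    by_cases hy : y = x
    · subst hy
      rw [Function.update_self, hw]
    · rw [Function.update_of_ne hy]
      rfl

theorem IsCompatibleMGU.swap {M : L.Structure D} {w : ℕ → D} {s t : L.Term ℕ}
    {E : List (L.Term ℕ × L.Term ℕ)} {σ : ℕ → L.Term ℕ}
    (h : IsCompatibleMGU M w ((s, t) :: E) σ) : IsCompatibleMGU M w ((t, s) :: E) σ := by
  have key : ∀ τ, Unifies τ ((s, t) :: E) ↔ Unifies τ ((t, s) :: E) := by
    intro τ
    simp [Unifies, eq_comm]
  exact ⟨(key σ).1 h.unifies, fun τ hτ => h.general τ ((key τ).2 hτ), h.value⟩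

/-- Equations that are satisfied in a model of the free equality axioms have a most general
unifier. -/
theorem exists_isCompatibleMGU {M : L.Structure D} (hM : FreeEquality M) (w : ℕ → D)
    (V : Finset ℕ) (E : List (L.Term ℕ × L.Term ℕ))
    (hV : ∀ e ∈ E, termVars e.1 ⊆ V ∧ termVars e.2 ⊆ V) (hE : EquationsHold M w E) :
    ∃ σ, IsCompatibleMGU M w E σ := by
  -- Lexicographic induction: elimination removes a variable from `V`; the other reductions keep `V`
  -- and shrink the equations.
  induction hn : V.card using Nat.strong_induction_on generalizing V E with
  | _ n ihV =>
  subst hn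
  induction hk : equationsSize E using Nat.strong_induction_on generalizing E with
  | _ k ihE =>
  subst hk
  have elim : ∀ (x : ℕ) (t : L.Term ℕ) (F : List (L.Term ℕ × L.Term ℕ)),
      (∀ e ∈ (Term.var x, t) :: F, termVars e.1 ⊆ V ∧ termVars e.2 ⊆ V) →
      EquationsHold M w ((Term.var x, t) :: F) → t ≠ Term.var x →
      ∃ σ, IsCompatibleMGU M w ((Term.var x, t) :: F) σ := by
    intro x t F hVF hF htx
    have hwx : w x = termValue M w t := hF _ List.mem_cons_self
    -- The occurs check cannot fail, because `x = t` has a solution in `M` and `M` is acyclic.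
    have hx : x ∉ termVars t := fun hx => hM.acyclic x t hx htx w hwx.symm
    have hxV : x ∈ V := (hVF _ List.mem_cons_self).1 (mem_termVars_var.2 rfl)
    have hupd : (fun y => termValue M w (Function.update Term.var x t y : L.Term ℕ)) = w := by
      funext y
      by_cases hy : y = x
      · subst hy
        rw [Function.update_self, hwx]
      · rw [Function.update_of_ne hy]
        rfl
    have hvars : ∀ s : L.Term ℕ, termVars s ⊆ V →
        termVars (s.subst (Function.update Term.var x t)) ⊆ (V.erase x : Finset ℕ) := by
      intro s hs y hy
      obtain ⟨z, hz, hy⟩ := mem_termVars_subst.1 hy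
      rw [Finset.coe_erase]
      by_cases hzx : z = x
      · subst hzx
        rw [Function.update_self] at hy
        exact ⟨(hVF _ List.mem_cons_self).2 hy, fun h => hx (h ▸ hy)⟩
      · rw [Function.update_of_ne hzx, mem_termVars_var] at hy
        subst hy
        exact ⟨hs hz, hzx⟩
    obtain ⟨σ, hσ⟩ := ihV _ (Finset.card_erase_lt_of_mem hxV) (V.erase x)
      (F.map fun e => (e.1.subst (Function.update Term.var x t),
        e.2.subst (Function.update Term.var x t)))
      (by
        intro e he
        obtain ⟨e, he', rfl⟩ := List.mem_map.1 he
        have := hVF e (List.mem_cons_of_mem _ he')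
        exact ⟨hvars _ this.1, hvars _ this.2⟩)
      (by
        intro e he
        obtain ⟨e, he', rfl⟩ := List.mem_map.1 he
        simp only [termValue_subst, hupd]
        exact hF e (List.mem_cons_of_mem _ he')) rfl
    exact ⟨_, hσ.eliminate hx hwx⟩
  match E with
  | [] => exact ⟨Term.var, by simp [Unifies], fun τ _ x => rfl, fun x => rfl⟩
  | (Term.var x, t) :: F =>
    by_cases htx : t = Term.var x
    · subst htx
      obtain ⟨σ, hσ⟩ := ihE _ (by simp [equationsSize, termSize]) F
        (fun e he => hV e (List.mem_cons_of_mem _ he))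
        (fun e he => hE e (List.mem_cons_of_mem _ he)) rfl
      refine ⟨σ, ?_, fun τ hτ => hσ.general τ fun e he => hτ e (List.mem_cons_of_mem _ he),
        hσ.value⟩
      intro e he
      rcases List.mem_cons.1 he with rfl | he
      · rfl
      · exact hσ.unifies e he
    · exact elim x t F hV hE htx
  | (Term.func f ts, Term.var x) :: F =>
    obtain ⟨σ, hσ⟩ := elim x (Term.func f ts) F
      (by
        intro e he
        rcases List.mem_cons.1 he with rfl | he
        · exact (hV _ List.mem_cons_self).symm
        · exact hV e (List.mem_cons_of_mem _ he))
      (by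
        intro e he
        rcases List.mem_cons.1 he with rfl | he
        · exact (hE _ List.mem_cons_self).symm
        · exact hE e (List.mem_cons_of_mem _ he)) (by simp)
    exact ⟨σ, hσ.swap⟩
  | (Term.func (l := n) f ts, Term.func (l := k) g us) :: F =>
    have hfg := hE _ List.mem_cons_self
    simp only [termValue_func] at hfg
    -- A clash of function symbols would contradict the distinctness axioms; for equal symbols,
    -- injectivity makes the argument equations true under `w`.
    by_cases hsym : (⟨n, f⟩ : Σ n, L.Functions n) = ⟨k, g⟩
    swap
    · exact absurd hfg (hM.distinct _ _ _ _ _ _ hsym)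
    cases hsym
    have hargs := hM.injective _ _ _ _ hfg
    have hun : ∀ τ, Unifies τ (List.ofFn (fun i => (ts i, us i)) ++ F) ↔
        Unifies τ ((Term.func f ts, Term.func f us) :: F) := by
      intro τ
      simp only [Unifies, List.mem_append, List.mem_ofFn, List.mem_cons, or_imp, forall_and,
        forall_eq, forall_exists_index, forall_apply_eq_imp_iff, Term.subst]
      refine and_congr_left fun _ => ?_
      simp [funext_iff]
    obtain ⟨σ, hσ⟩ := ihE _
      (by
        simp only [equationsSize, List.map_append, List.map_ofFn, List.sum_append, List.map_cons,
          List.sum_cons, termSize, List.sum_ofFn, Function.comp_def, Finset.sum_add_distrib]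
        omega)
      (List.ofFn (fun i => (ts i, us i)) ++ F)
      (by
        intro e he
        rcases List.mem_append.1 he with he | he
        · obtain ⟨i, rfl⟩ := List.mem_ofFn.1 he
          have := hV _ List.mem_cons_self
          exact ⟨fun x hx => this.1 (mem_termVars_func.2 ⟨i, hx⟩),
            fun x hx => this.2 (mem_termVars_func.2 ⟨i, hx⟩)⟩
        · exact hV e (List.mem_cons_of_mem _ he))
      (by
        intro e he
        rcases List.mem_append.1 he with he | he
        · obtain ⟨i, rfl⟩ := List.mem_ofFn.1 he
          exact congrFun hargs i
        · exact hE e (List.mem_cons_of_mem _ he)) rfl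
    exact ⟨σ, (hun σ).1 hσ.unifies, fun τ hτ => hσ.general τ ((hun τ).2 hτ), hσ.value⟩

end Unification

/-! ### Variables and truth of literals -/

section Literals

open FirstOrder.Language

variable {L : FirstOrder.Language.{u, v}} {D : Type w} {α β : Type}

theorem Query.vars_finite (Q : Query L) : (Query.vars Q).Finite := by
  have : Query.vars Q = ⋃ l ∈ {l | l ∈ Q}, ⋃ i, termVars (l.atom.args i) := by
    ext x
    simp [Query.vars, Literal.vars, Atom.vars]
  rw [this]
  exact Q.finite_toSet.biUnion fun l _ => Set.finite_iUnion fun i => Finset.finite_toSet _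

theorem Clause.vars_finite (c : Clause L ℕ) : c.vars.Finite := by
  refine Set.Finite.union ?_ (Query.vars_finite _)
  have : c.head.vars = ⋃ i, termVars (c.head.args i) := by
    ext x
    simp [Atom.vars]
  rw [this]
  exact Set.finite_iUnion fun i => Finset.finite_toSet _

theorem Atom.mem_vars_subst {A : Atom L ℕ} {σ : ℕ → L.Term ℕ} {y : ℕ} :
    y ∈ (A.subst σ).vars ↔ ∃ x ∈ A.vars, y ∈ termVars (σ x) := by
  constructor
  · rintro ⟨i, hi⟩
    obtain ⟨x, hx, hy⟩ := mem_termVars_subst.1 hi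
    exact ⟨x, ⟨i, hx⟩, hy⟩
  · rintro ⟨x, ⟨i, hx⟩, hy⟩
    exact ⟨i, mem_termVars_subst.2 ⟨x, hx, hy⟩⟩

theorem Literal.atom_subst (l : Literal L α) (σ : α → L.Term β) :
    (l.subst σ).atom = l.atom.subst σ := by
  cases l <;> rfl

theorem Literal.sym_subst (l : Literal L α) (σ : α → L.Term β) : (l.subst σ).sym = l.sym := by
  cases l <;> rfl

theorem Literal.subst_subst (l : Literal L ℕ) (σ : ℕ → L.Term ℕ) (τ : ℕ → L.Term β) :
    (l.subst σ).subst τ = l.subst fun x => (σ x).subst τ := by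
  cases l <;> simp [Literal.subst, Atom.subst, LogicProg.subst_subst]

theorem Clause.mem_vars_subst {c : Clause L ℕ} {σ : ℕ → L.Term ℕ} {y : ℕ}
    (hy : y ∈ (c.subst σ).vars) : ∃ x ∈ c.vars, y ∈ termVars (σ x) := by
  rcases hy with hy | ⟨l, hl, hy⟩
  · obtain ⟨x, hx, hy⟩ := Atom.mem_vars_subst.1 hy
    exact ⟨x, Or.inl hx, hy⟩
  · obtain ⟨l, hl', rfl⟩ := List.mem_map.1 hl
    rw [Literal.vars, Literal.atom_subst] at hy
    obtain ⟨x, hx, hy⟩ := Atom.mem_vars_subst.1 hy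
    exact ⟨x, Or.inr ⟨l, hl', hx⟩, hy⟩

theorem Atom.holds_subst {M : L.Structure D} {v : β → D} {A : Atom L α} {σ : α → L.Term β} :
    (A.subst σ).Holds M v ↔ A.Holds M fun x => termValue M v (σ x) := by
  simp only [Atom.Holds, Atom.subst, termValue_subst]

theorem Literal.holds_subst {M : L.Structure D} {v : β → D} {l : Literal L α}
    {σ : α → L.Term β} : (l.subst σ).Holds M v ↔ l.Holds M fun x => termValue M v (σ x) := by
  cases l
  · exact Atom.holds_subst
  · exact not_congr Atom.holds_subst

theorem Atom.holds_congr {M : L.Structure D} {v v' : ℕ → D} {A : Atom L ℕ}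
    (h : ∀ x ∈ A.vars, v x = v' x) : A.Holds M v ↔ A.Holds M v' := by
  have : (fun i => termValue M v (A.args i)) = fun i => termValue M v' (A.args i) :=
    funext fun i => termValue_congr M _ fun x hx => h x ⟨i, hx⟩
  simp only [Atom.Holds, this]

theorem Literal.holds_congr {M : L.Structure D} {v v' : ℕ → D} {l : Literal L ℕ}
    (h : ∀ x ∈ l.vars, v x = v' x) : l.Holds M v ↔ l.Holds M v' := by
  cases l
  · exact Atom.holds_congr h
  · exact not_congr (Atom.holds_congr h)

theorem Literal.holds_restrict {M : L.Structure D} {S : Set (RelSym L)} {v : α → D}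
    {l : Literal L α} (hl : l.sym ∈ S) : l.Holds (restrict M S) v ↔ l.Holds M v := by
  have key : ∀ A : Atom L α, A.sym ∈ S → (A.Holds (restrict M S) v ↔ A.Holds M v) := by
    intro A hA
    simp only [Atom.Holds, termValue_restrict]
    exact and_iff_right hA
  cases l
  · exact key _ hl
  · exact not_congr (key _ hl)

theorem FreeEquality.of_restrict {M : L.Structure D} {S : Set (RelSym L)}
    (h : FreeEquality (restrict M S)) : FreeEquality M :=
  ⟨h.injective, h.distinct, fun x t hx ht v => by
    simpa only [termValue_restrict] using h.acyclic x t hx ht v⟩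

end Literals

/-! ### Existence of resolvents -/

section Resolvents

open FirstOrder.Language

variable {L : FirstOrder.Language.{u, v}} {D : Type w}

/-- A renaming has to be a permutation of all variables, so the blocks `0..N` and `N+1..2N+1` are
exchanged, where `N` bounds both sets. -/
theorem exists_perm_disjoint {F C : Set ℕ} (hF : F.Finite) (hC : C.Finite) :
    ∃ ρ : Equiv.Perm ℕ, ∀ x ∈ C, ρ x ∉ F := by
  obtain ⟨N, hN⟩ := (hF.union hC).bddAbove
  let g : ℕ → ℕ := fun x => if x ≤ N then x + (N + 1) else if x ≤ 2 * N + 1 then x - (N + 1) else x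
  have hg : Function.Involutive g := by
    intro x
    simp only [g]
    split_ifs <;> omega
  refine ⟨hg.toPerm, fun x hx hxF => ?_⟩
  have h1 : x ≤ N := hN (Or.inr hx)
  have h2 : g x ≤ N := hN (Or.inl hxF)
  simp only [g, if_pos h1] at h2
  omega

/-- If the first atom of a query that holds in a model of the free equality axioms is true because
of an instance of a program clause, then the query has a resolvent that holds as well. -/
theorem exists_resolvent_holds {M : L.Structure D} (hM : FreeEquality M) {P : Program L} {n : ℕ}
    {p : L.Relations n} {s t : Fin n → L.Term ℕ} {B body : Query L} {v v' : ℕ → D}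
    (hc : (⟨⟨n, p, t⟩, body⟩ : Clause L ℕ) ∈ P)
    (harg : ∀ i, termValue M v (s i) = termValue M v' (t i))
    (hB : ∀ l ∈ B, l.Holds M v) (hbody : ∀ l ∈ body, l.Holds M v') :
    ∃ Q', Resolvent P (Literal.pos ⟨n, p, s⟩ :: B) Q' ∧ ∃ w : ℕ → D, ∀ l ∈ Q', l.Holds M w := by
  classical
  set Q : Query L := Literal.pos ⟨n, p, s⟩ :: B with hQ
  set c : Clause L ℕ := ⟨⟨n, p, t⟩, body⟩ with hcdef
  obtain ⟨ρ, hρ⟩ := exists_perm_disjoint (Query.vars_finite Q) c.vars_finite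
  -- After renaming apart, the assignments for the query and for the clause have disjoint domains
  -- and can be glued.
  let w : ℕ → D := fun x => if x ∈ Query.vars Q then v x else v' (ρ.symm x)
  have hwQ : ∀ x ∈ Query.vars Q, w x = v x := fun x hx => if_pos hx
  have hwc : ∀ x ∈ c.vars, w (ρ x) = v' x := by
    intro x hx
    simp only [w, if_neg (hρ x hx), Equiv.symm_apply_apply]
  have hwB : ∀ l ∈ B, l.Holds M w := by
    intro l hl
    refine (Literal.holds_congr fun x hx => hwQ x ?_).2 (hB l hl)
    exact ⟨l, List.mem_cons_of_mem _ hl, hx⟩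
  have hwbody : ∀ l ∈ body, (l.subst fun x => (Term.var (ρ x) : L.Term ℕ)).Holds M w := by
    intro l hl
    refine Literal.holds_subst.2 ((Literal.holds_congr fun x hx => ?_).2 (hbody l hl))
    exact hwc x (Or.inr ⟨l, hl, hx⟩)
  let E : List (L.Term ℕ × L.Term ℕ) :=
    List.ofFn fun i => (s i, (t i).subst fun x => Term.var (ρ x))
  have hE : EquationsHold M w E := by
    intro e he
    obtain ⟨i, rfl⟩ := List.mem_ofFn.1 he
    have h1 : termValue M w (s i) = termValue M v (s i) :=
      termValue_congr M _ fun x hx => hwQ x ⟨_, List.mem_cons_self, i, hx⟩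
    have h2 : termValue M w ((t i).subst fun x => (Term.var (ρ x) : L.Term ℕ)) =
        termValue M v' (t i) := by
      rw [termValue_subst]
      exact termValue_congr M _ fun x hx => hwc x (Or.inl ⟨i, hx⟩)
    exact h1.trans ((harg i).trans h2.symm)
  have hfin : ({x | ∃ e ∈ E, x ∈ termVars e.1 ∪ termVars e.2} : Set ℕ).Finite := by
    have : ({x | ∃ e ∈ E, x ∈ termVars e.1 ∪ termVars e.2} : Set ℕ) =
        ⋃ e ∈ {e | e ∈ E}, (termVars e.1 ∪ termVars e.2) := by
      ext x
      simp
    rw [this]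
    exact E.finite_toSet.biUnion fun e _ =>
      (Finset.finite_toSet _).union (Finset.finite_toSet _)
  obtain ⟨σ, hσ⟩ := exists_isCompatibleMGU hM w hfin.toFinset E
    (fun e he => by
      simp only [Set.Finite.coe_toFinset]
      exact ⟨fun x hx => ⟨e, he, Or.inl hx⟩, fun x hx => ⟨e, he, Or.inr hx⟩⟩) hE
  have hunif : ∀ τ : ℕ → L.Term ℕ,
      (⟨n, p, s⟩ : Atom L ℕ).subst τ = (c.subst fun x => Term.var (ρ x)).head.subst τ ↔
        Unifies τ E := by
    intro τ
    simp only [Unifies, E, List.mem_ofFn, forall_exists_index,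
      forall_apply_eq_imp_iff, Atom.subst, Clause.subst, hcdef, Atom.mk.injEq, heq_eq_eq, true_and,
      funext_iff]
    exact and_iff_right rfl
  refine ⟨_, Resolvent.intro _ B c _ σ hc ⟨ρ, rfl⟩ ?_
    ⟨(hunif σ).2 hσ.unifies, fun τ hτ => ⟨τ, hσ.general τ ((hunif τ).1 hτ)⟩⟩, w, ?_⟩
  · rw [Set.disjoint_left]
    intro y hy
    obtain ⟨x, hx, hy⟩ := Clause.mem_vars_subst hy
    rw [mem_termVars_var.1 hy]
    exact hρ x hx
  · intro l hl
    obtain ⟨l, hl', rfl⟩ := List.mem_map.1 hl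
    -- Compatibility says that evaluating `σ` under `w` gives `w` back, so applying `σ` does not
    -- change truth under `w`.
    rw [Literal.holds_subst, ← funext hσ.value]
    rcases List.mem_append.1 hl' with hl' | hl'
    · obtain ⟨l, hl'', rfl⟩ := List.mem_map.1 hl'
      exact hwbody l hl''
    · exact hwB l hl'

end Resolvents

/-! ### Soundness of negation as finite failure -/

section Soundness

open FirstOrder.Language

variable {L : FirstOrder.Language.{u, v}} {D : Type w} {P : Program L} {M : L.Structure D}

/-- What a resolution step with a clause `c` does, without the conditions on the variables. -/
theorem Resolvent.exists_clause {A : Atom L ℕ} {B Q' : Query L}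
    (h : Resolvent P (Literal.pos A :: B) Q') :
    ∃ c ∈ P, ∃ (c' : Clause L ℕ) (σ : ℕ → L.Term ℕ), c'.IsVariant c ∧
      Disjoint c'.vars (Query.vars (Literal.pos A :: B)) ∧ IsMGU σ A c'.head ∧
      Q' = Query.subst (c'.body ++ B) σ := by
  cases h with
  | intro _ _ c c' σ hc hvar hdisj hmgu => exact ⟨c, hc, c', σ, hvar, hdisj, hmgu, rfl⟩

theorem Resolvent.exists_cons {Q Q' : Query L} (h : Resolvent P Q Q') :
    ∃ A B, Q = Literal.pos A :: B := by
  cases h with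
  | intro A B => exact ⟨A, B, rfl⟩

theorem IsMGU.sym_eq {σ : ℕ → L.Term ℕ} {A B : Atom L ℕ} (h : IsMGU σ A B) : A.sym = B.sym := by
  have := congrArg Atom.sym h.1
  exact this

theorem Clause.IsVariant.head_sym {c c' : Clause L ℕ} (h : c'.IsVariant c) :
    c'.head.sym = c.head.sym := by
  obtain ⟨ρ, rfl⟩ := h
  rfl

theorem Clause.IsVariant.exists_body {c c' : Clause L ℕ} (h : c'.IsVariant c) {l : Literal L ℕ}
    (hl : l ∈ c'.body) : ∃ l' ∈ c.body, ∃ σ : ℕ → L.Term ℕ, l = l'.subst σ := by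
  obtain ⟨ρ, rfl⟩ := h
  obtain ⟨l', hl', rfl⟩ := List.mem_map.1 hl
  exact ⟨l', hl', _, rfl⟩

theorem Clause.IsVariant.head_holds (hM : IsModel M P) {c c' : Clause L ℕ} (hc : c ∈ P)
    (h : c'.IsVariant c) {v : ℕ → D} (hv : ∀ l ∈ c'.body, l.Holds M v) : c'.head.Holds M v := by
  obtain ⟨ρ, rfl⟩ := h
  refine Atom.holds_subst.2 (hM c hc _ fun l hl => ?_)
  exact Literal.holds_subst.1 (hv _ (List.mem_map.2 ⟨l, hl, rfl⟩))

theorem negStar_of_body {c : Clause L ℕ} (hc : c ∈ P) (hhead : c.head.sym ∈ negStar P)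
    {l : Literal L ℕ} (hl : l ∈ c.body) : l.sym ∈ negStar P := by
  obtain ⟨p, hp, hdep⟩ := hhead
  exact ⟨p, hp, hdep.tail ⟨c, hc, rfl, l, hl, rfl⟩⟩

/-- The relations of a resolvent satisfy every condition that is satisfied by those of the query
and by those of the bodies of the clauses defining the first one. -/
theorem Resolvent.sym_induction {A : Atom L ℕ} {B Q' : Query L} {q : RelSym L → Prop}
    (h : Resolvent P (Literal.pos A :: B) Q') (hB : ∀ l ∈ B, q l.sym)
    (hbody : ∀ c ∈ P, c.head.sym = A.sym → ∀ l ∈ c.body, q l.sym) : ∀ l ∈ Q', q l.sym := by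
  obtain ⟨c, hc, c', σ, hvar, -, hmgu, rfl⟩ := h.exists_clause
  intro l hl
  obtain ⟨l, hl', rfl⟩ := List.mem_map.1 hl
  rw [Literal.sym_subst]
  rcases List.mem_append.1 hl' with hl' | hl'
  · obtain ⟨l', hl'', τ, rfl⟩ := hvar.exists_body hl'
    rw [Literal.sym_subst]
    exact hbody c hc (hvar.head_sym.symm.trans hmgu.sym_eq.symm) l' hl''
  · exact hB l hl'

theorem Atom.IsGround.holds_iff {A : Atom L ℕ} (hA : A.IsGround) (v v' : ℕ → D) :
    A.Holds M v ↔ A.Holds M v' :=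
  Atom.holds_congr fun x hx => by
    rw [hA] at hx
    exact hx.elim

/-- Success and finite failure call each other through negation, so the proof is a mutual induction:
a successful query is satisfiable in `M`, a finitely failed one is not. The first half uses that `M`
is a model, the second the completed definitions. Restricting to `negStar P` is harmless, since this
set is closed under passing to clause bodies. -/
theorem FinitelyFailed.not_holds (hM : IsCompleteModel M P) {Q : Query L}
    (hfail : FinitelyFailed P Q) (hQ : ∀ l ∈ Q, l.sym ∈ negStar P) (v : ℕ → D) :
    ¬ ∀ l ∈ Q, l.Holds M v := by
  have body : ∀ {A : Atom L ℕ}, A.sym ∈ negStar P → ∀ c ∈ P, c.head.sym = A.sym →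
      ∀ l ∈ c.body, l.sym ∈ negStar P :=
    fun hA c hc h l hl => negStar_of_body hc (h ▸ hA) hl
  refine FinitelyFailed.rec
    (motive_1 := fun Q _ => (∀ l ∈ Q, l.sym ∈ negStar P) → Nonempty D →
      ∃ v : ℕ → D, ∀ l ∈ Q, l.Holds M v)
    (motive_2 := fun Q _ => (∀ l ∈ Q, l.sym ∈ negStar P) →
      ∀ v : ℕ → D, ¬ ∀ l ∈ Q, l.Holds M v)
    ?_ ?_ ?_ ?_ ?_ ?_ hfail hQ v
  · rintro - ⟨d⟩
    exact ⟨fun _ => d, by simp⟩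
  · intro Q Q' hres _ ih hQ hD
    obtain ⟨A, B, rfl⟩ := hres.exists_cons
    obtain ⟨v, hv⟩ := ih (hres.sym_induction (fun l hl => hQ l (List.mem_cons_of_mem _ hl))
      (body (hQ _ List.mem_cons_self))) hD
    obtain ⟨c, hc, c', σ, hvar, -, hmgu, rfl⟩ := hres.exists_clause
    have hv' : ∀ l ∈ c'.body ++ B, l.Holds M fun x => termValue M v (σ x) :=
      fun l hl => Literal.holds_subst.1 (hv _ (List.mem_map.2 ⟨l, hl, rfl⟩))
    refine ⟨fun x => termValue M v (σ x), fun l hl => ?_⟩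
    rcases List.mem_cons.1 hl with rfl | hl
    · have := hvar.head_holds hM.1 hc fun l hl => hv' l (List.mem_append_left _ hl)
      rw [← Atom.holds_subst, ← hmgu.1, Atom.holds_subst] at this
      exact this
    · exact hv' l (List.mem_append_right _ hl)
  · intro A B hA _ _ ih1 ih2 hQ hD
    obtain ⟨v, hv⟩ := ih2 (fun l hl => hQ l (List.mem_cons_of_mem _ hl)) hD
    refine ⟨v, fun l hl => ?_⟩
    rcases List.mem_cons.1 hl with rfl | hl
    · intro h
      refine ih1 ?_ v ?_
      · simpa [Literal.sym, Literal.atom] using hQ _ List.mem_cons_self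
      · intro l hl
        rw [List.mem_singleton.1 hl]
        exact h
    · exact hv l hl
  · intro A B hall ih hQ v hv
    obtain ⟨n, p, s⟩ := A
    have hp : (⟨n, p⟩ : RelSym L) ∈ negStar P := hQ _ List.mem_cons_self
    have hA : M.RelMap p fun i => termValue M v (s i) := hv _ List.mem_cons_self
    -- The only-if half of the completed definition: a true atom is supported by a clause instance
    -- with true body. The existence of this clause also makes the free equality axioms available.
    obtain ⟨t, b, hc, v', harg, hb⟩ := (hM.2.1 n p fun i => termValue M v (s i)).1 ⟨hp, hA⟩
    simp only [termValue_restrict] at harg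
    obtain ⟨Q', hres, w, hw⟩ := exists_resolvent_holds (hM.2.2 ⟨_, hc⟩).of_restrict hc.1 harg
      (fun l hl => hv l (List.mem_cons_of_mem _ hl))
      (fun l hl => (Literal.holds_restrict (negStar_of_body hc.1 hp hl)).1 (hb l hl))
    exact ih Q' hres (hres.sym_induction (fun l hl => hQ l (List.mem_cons_of_mem _ hl))
      (body hp)) w hw
  · intro A B hA _ ih hQ v hv
    obtain ⟨v', hv'⟩ := ih (by
      simpa [Literal.sym, Literal.atom] using hQ _ List.mem_cons_self) ⟨v 0⟩
    -- Success gives only some assignment making `A` true; groundness transfers this to the given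
    -- one.
    exact hv _ List.mem_cons_self ((hA.holds_iff v' v).1 (hv' _ List.mem_cons_self))
  · intro A B hA _ _ _ ih hQ v hv
    exact ih (fun l hl => hQ l (List.mem_cons_of_mem _ hl)) v
      fun l hl => hv l (List.mem_cons_of_mem _ hl)

end Soundness

/-! ### Well-modedness -/

section WellModed

open FirstOrder.Language

variable {L : FirstOrder.Language.{u, v}} {m : Moding L}

/-- A sequence of literals is well-moded relative to a set of variables that are available
beforehand. -/
def WellModedFrom (m : Moding L) : Set ℕ → List (Literal L ℕ) → Prop
  | _, [] => True
  | V, l :: Q => l.atom.inVars m ⊆ V ∧ WellModedFrom m (V ∪ l.atom.outVars m) Q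

theorem seqOutVars_nil : seqOutVars m ([] : List (Literal L ℕ)) = ∅ := by
  ext x
  simp [seqOutVars]

theorem seqOutVars_cons (l : Literal L ℕ) (Q : List (Literal L ℕ)) :
    seqOutVars m (l :: Q) = l.atom.outVars m ∪ seqOutVars m Q := by
  ext x
  simp [seqOutVars]

theorem wellModedFrom_iff {V : Set ℕ} {Q : List (Literal L ℕ)} :
    WellModedFrom m V Q ↔ ∀ (pre : Query L) (l : Literal L ℕ) (post : Query L),
      Q = pre ++ l :: post → l.atom.inVars m ⊆ V ∪ seqOutVars m pre := by
  induction Q generalizing V with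
  | nil => simp [WellModedFrom]
  | cons a Q ih =>
    rw [WellModedFrom, ih]
    constructor
    · rintro ⟨ha, h⟩ pre l post heq
      cases pre with
      | nil =>
        obtain ⟨rfl, rfl⟩ := List.cons.inj heq
        exact ha.trans Set.subset_union_left
      | cons b pre =>
        obtain ⟨rfl, heq'⟩ := List.cons.inj heq
        rw [seqOutVars_cons, ← Set.union_assoc]
        exact h pre l post heq'
    · intro h
      refine ⟨?_, fun pre l post heq => ?_⟩
      · simpa [seqOutVars_nil] using h [] a Q rfl
      · have := h (a :: pre) l post (congrArg _ heq)
        rwa [seqOutVars_cons, ← Set.union_assoc] at this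

theorem wellModedQuery_iff {Q : Query L} : WellModedQuery m Q ↔ WellModedFrom m ∅ Q := by
  rw [wellModedFrom_iff]
  simp [WellModedQuery]

theorem wellModedFrom_append {V : Set ℕ} {Q Q' : List (Literal L ℕ)} :
    WellModedFrom m V (Q ++ Q') ↔
      WellModedFrom m V Q ∧ WellModedFrom m (V ∪ seqOutVars m Q) Q' := by
  induction Q generalizing V with
  | nil => simp [WellModedFrom, seqOutVars_nil]
  | cons a Q ih =>
    rw [List.cons_append, WellModedFrom, WellModedFrom, ih, seqOutVars_cons, ← Set.union_assoc,
      and_assoc]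

theorem Atom.mem_inVars_subst {A : Atom L ℕ} {σ : ℕ → L.Term ℕ} {y : ℕ} :
    y ∈ (A.subst σ).inVars m ↔ ∃ x ∈ A.inVars m, y ∈ termVars (σ x) := by
  constructor
  · rintro ⟨i, hi, hy⟩
    obtain ⟨x, hx, hy⟩ := mem_termVars_subst.1 hy
    exact ⟨x, ⟨i, hi, hx⟩, hy⟩
  · rintro ⟨x, ⟨i, hi, hx⟩, hy⟩
    exact ⟨i, hi, mem_termVars_subst.2 ⟨x, hx, hy⟩⟩

theorem Atom.mem_outVars_subst {A : Atom L ℕ} {σ : ℕ → L.Term ℕ} {y : ℕ} :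
    y ∈ (A.subst σ).outVars m ↔ ∃ x ∈ A.outVars m, y ∈ termVars (σ x) := by
  constructor
  · rintro ⟨i, hi, hy⟩
    obtain ⟨x, hx, hy⟩ := mem_termVars_subst.1 hy
    exact ⟨x, ⟨i, hi, hx⟩, hy⟩
  · rintro ⟨x, ⟨i, hi, hx⟩, hy⟩
    exact ⟨i, hi, mem_termVars_subst.2 ⟨x, hx, hy⟩⟩

theorem mem_seqOutVars_subst {Q : Query L} {σ : ℕ → L.Term ℕ} {y : ℕ} :
    y ∈ seqOutVars m (Q.subst σ) ↔ ∃ x ∈ seqOutVars m Q, y ∈ termVars (σ x) := by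
  constructor
  · rintro ⟨l, hl, hy⟩
    obtain ⟨l, hl', rfl⟩ := List.mem_map.1 hl
    rw [Literal.atom_subst] at hy
    obtain ⟨x, hx, hy⟩ := Atom.mem_outVars_subst.1 hy
    exact ⟨x, ⟨l, hl', hx⟩, hy⟩
  · rintro ⟨x, ⟨l, hl, hx⟩, hy⟩
    refine ⟨l.subst σ, List.mem_map.2 ⟨l, hl, rfl⟩, ?_⟩
    rw [Literal.atom_subst]
    exact Atom.mem_outVars_subst.2 ⟨x, hx, hy⟩

theorem WellModedFrom.subst {V W : Set ℕ} {Q : Query L} {σ : ℕ → L.Term ℕ}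
    (h : WellModedFrom m V Q) (hV : ∀ x ∈ V, termVars (σ x) ⊆ W) :
    WellModedFrom m W (Q.subst σ) := by
  induction Q generalizing V W with
  | nil => trivial
  | cons a Q ih =>
    refine ⟨?_, ih h.2 ?_⟩
    · intro y hy
      rw [Literal.atom_subst] at hy
      obtain ⟨x, hx, hy⟩ := Atom.mem_inVars_subst.1 hy
      exact hV x (h.1 hx) hy
    · rintro x (hx | hx) y hy
      · exact Or.inl (hV x hx hy)
      · refine Or.inr ?_
        rw [Literal.atom_subst]
        exact Atom.mem_outVars_subst.2 ⟨x, hx, hy⟩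

theorem WellModedClause.subst {c : Clause L ℕ} (h : WellModedClause m c) (σ : ℕ → L.Term ℕ) :
    WellModedClause m (c.subst σ) := by
  refine ⟨wellModedFrom_iff.1 ((wellModedFrom_iff.2 h.1).subst fun x hx y hy =>
    Atom.mem_inVars_subst.2 ⟨x, hx, hy⟩), fun y hy => ?_⟩
  obtain ⟨x, hx, hy⟩ := Atom.mem_outVars_subst.1 hy
  rcases h.2 hx with hx | hx
  · exact Or.inl (Atom.mem_inVars_subst.2 ⟨x, hx, hy⟩)
  · exact Or.inr (mem_seqOutVars_subst.2 ⟨x, hx, hy⟩)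

theorem WellModedClause.of_isVariant {c c' : Clause L ℕ} (h : WellModedClause m c)
    (hvar : c'.IsVariant c) : WellModedClause m c' := by
  obtain ⟨ρ, rfl⟩ := hvar
  exact h.subst _

/-- Resolution preserves well-modedness. -/
theorem WellModedFrom.resolve {A : Atom L ℕ} {B : Query L} {c : Clause L ℕ} {σ : ℕ → L.Term ℕ}
    (hQ : WellModedFrom m ∅ (Literal.pos A :: B)) (hc : WellModedClause m c)
    (hσ : A.subst σ = c.head.subst σ) : WellModedFrom m ∅ (Query.subst (c.body ++ B) σ) := by
  -- The selected atom has ground inputs and unification equates them with those of the head, so `σ`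
  -- grounds the head's input variables.
  have hin : ∀ x ∈ c.head.inVars m, termVars (σ x) ⊆ ∅ := by
    intro x hx y hy
    have : y ∈ (A.subst σ).inVars m := hσ ▸ Atom.mem_inVars_subst.2 ⟨x, hx, hy⟩
    obtain ⟨z, hz, -⟩ := Atom.mem_inVars_subst.1 this
    exact (hQ.1 hz).elim
  rw [Query.subst, List.map_append]
  refine wellModedFrom_append.2 ⟨(wellModedFrom_iff.2 hc.1).subst hin, hQ.2.subst ?_⟩
  rintro x (hx | hx) y hy
  · exact hx.elim
  have : y ∈ (c.head.subst σ).outVars m := hσ ▸ Atom.mem_outVars_subst.2 ⟨x, hx, hy⟩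
  obtain ⟨z, hz, hy⟩ := Atom.mem_outVars_subst.1 this
  -- Variables that the rest of the query expected from the outputs of `A` are now supplied by the
  -- outputs of the clause body.
  rcases hc.2 hz with hz | hz
  · exact (hin z hz hy).elim
  · exact Or.inr (mem_seqOutVars_subst.2 ⟨z, hz, hy⟩)

theorem Atom.IsGround.outVars_eq {A : Atom L ℕ} (hA : A.IsGround) : A.outVars m = ∅ := by
  refine Set.eq_empty_of_forall_notMem fun x => ?_
  rintro ⟨i, -, hx⟩
  have : x ∈ A.vars := ⟨i, hx⟩
  rw [hA] at this
  exact this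

theorem WellModedFrom.tail_of_isGround {l : Literal L ℕ} {B : Query L}
    (hQ : WellModedFrom m ∅ (l :: B)) (hA : l.atom.IsGround) : WellModedFrom m ∅ B := by
  have := hQ.2
  rwa [hA.outVars_eq, Set.union_self] at this

end WellModed

/-! ### Termination as accessibility -/

section Termination

open FirstOrder.Language

variable {L : FirstOrder.Language.{u, v}} {P R : Program L}

/-- `Next P Q' Q`: in the execution of `Q`, the query `Q'` is a child of `Q` or the root of a
subsidiary tree called by `Q`. -/
def Next (P : Program L) (Q' Q : Query L) : Prop := DerivationStep P Q Q' ∨ SubsidiaryCall Q Q'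

/-- Divergence is an infinite descending chain of `Next`; accessibility turns its absence into an
induction principle. -/
theorem allDerivationsFinite_iff_acc {Q : Query L} :
    AllDerivationsFinite P Q ↔ Acc (Next P) Q := by
  rw [AllDerivationsFinite, Diverges, ← not_iff_not, not_not, not_acc_iff_exists_descending_chain]
  rfl

theorem acc_of_resolvents {A : Atom L ℕ} {B : Query L}
    (h : ∀ Q', Resolvent P (Literal.pos A :: B) Q' → Acc (Next P) Q') :
    Acc (Next P) (Literal.pos A :: B) := by
  refine Acc.intro _ fun Q' hQ' => ?_
  rcases hQ' with hstep | hsub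
  · cases hstep with
    | resolve _ _ hres => exact h _ hres
  · cases hsub

theorem acc_nil : Acc (Next P) [] := by
  refine Acc.intro _ fun Q' hQ' => ?_
  rcases hQ' with hstep | hsub
  · cases hstep with
    | resolve _ _ hres => cases hres
  · cases hsub

theorem acc_neg {A : Atom L ℕ} (h : Acc (Next P) [Literal.pos A]) :
    Acc (Next P) [Literal.neg A] := by
  refine Acc.intro _ fun Q' hQ' => ?_
  rcases hQ' with hstep | hsub
  · cases hstep with
    | resolve _ _ hres => cases hres
    | naf => exact acc_nil
  · cases hsub
    exact h

theorem resolvent_of_append {A : Atom L ℕ} {B : Query L} {c c' : Clause L ℕ}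
    {σ : ℕ → L.Term ℕ} (hc : c ∈ P) (hvar : c'.IsVariant c) {Q : Query L}
    (hdisj : Disjoint c'.vars (Query.vars (Literal.pos A :: B ++ Q)))
    (hmgu : IsMGU σ A c'.head) :
    Resolvent P (Literal.pos A :: B) (Query.subst (c'.body ++ B) σ) := by
  refine Resolvent.intro A B c c' σ hc hvar (hdisj.mono_right ?_) hmgu
  rintro x ⟨l, hl, hx⟩
  exact ⟨l, List.mem_append_left _ hl, hx⟩

/-- If `Q₁` terminates and the relation `I` between the query that is being executed and the rest
of the query is invariant and ensures that the rest terminates once it is reached, then `Q₁, Q₂`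
terminates. -/
theorem acc_append (I : Query L → Query L → Prop)
    (hres : ∀ (A : Atom L ℕ) (B Q₂ : Query L) (c c' : Clause L ℕ) (σ : ℕ → L.Term ℕ),
      I (Literal.pos A :: B) Q₂ → c ∈ P → c'.IsVariant c → A.subst σ = c'.head.subst σ →
      I (Query.subst (c'.body ++ B) σ) (Query.subst Q₂ σ))
    (hnaf : ∀ (A : Atom L ℕ) (B Q₂ : Query L), I (Literal.neg A :: B) Q₂ → A.IsGround →
      FinitelyFailed P [Literal.pos A] → I B Q₂)
    (hnil : ∀ Q₂, I [] Q₂ → Acc (Next P) Q₂)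
    {Q₁ Q₂ : Query L} (hQ₁ : Acc (Next P) Q₁) (h : I Q₁ Q₂) : Acc (Next P) (Q₁ ++ Q₂) := by
  induction hQ₁ generalizing Q₂ with
  | intro Q₁ hacc ih =>
  match Q₁ with
  | [] => exact hnil Q₂ h
  | Literal.pos A :: B =>
    refine acc_of_resolvents fun Q' hQ' => ?_
    obtain ⟨c, hc, c', σ, hvar, hdisj, hmgu, rfl⟩ := hQ'.exists_clause
    -- A clause variant disjoint from the whole query is disjoint from `Q₁`, so the same step is a
    -- step of `Q₁`, while `Q₂` is merely instantiated by `σ`.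
    have := ih _ (Or.inl (DerivationStep.resolve _ _ (resolvent_of_append hc hvar hdisj hmgu)))
      (hres A B Q₂ c c' σ h hc hvar hmgu.1)
    have heq : Query.subst (c'.body ++ (B ++ Q₂)) σ =
        Query.subst (c'.body ++ B) σ ++ Query.subst Q₂ σ := by
      simp only [Query.subst, List.map_append, List.append_assoc]
    exact heq ▸ this
  | Literal.neg A :: B =>
    refine Acc.intro _ fun Q' hQ' => ?_
    rcases hQ' with hstep | hsub
    · cases hstep with
      | resolve _ _ hres' => cases hres'
      | naf _ _ hA hfail =>
        exact ih B (Or.inl (DerivationStep.naf A B hA hfail)) (hnaf A B Q₂ h hA hfail)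
    · cases hsub with
      | intro _ _ hA =>
        exact hacc _ (Or.inr (SubsidiaryCall.intro A B hA))

/-! ### Queries that do not involve the extending program -/

theorem Extends.not_defined_of_body (hext : Extends P R) {c : Clause L ℕ} (hc : c ∈ P ∪ R)
    (hhead : ¬ DefinedIn c.head.sym P) : c ∈ R ∧ ∀ l ∈ c.body, ¬ DefinedIn l.sym P := by
  have hcR : c ∈ R := hc.resolve_left fun h => hhead ⟨c, h, rfl⟩
  exact ⟨hcR, fun l hl h => hext _ h ⟨c, hcR, Or.inr ⟨l, hl, rfl⟩⟩⟩

theorem Resolvent.of_union {Q Q' : Query L} (hext : Extends P R)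
    (h : Resolvent (P ∪ R) Q Q') (hQ : ∀ l ∈ Q, ¬ DefinedIn l.sym P) :
    Resolvent R Q Q' ∧ ∀ l ∈ Q', ¬ DefinedIn l.sym P := by
  obtain ⟨A, B, rfl⟩ := h.exists_cons
  have hA : ¬ DefinedIn A.sym P := hQ _ List.mem_cons_self
  refine ⟨?_, h.sym_induction (q := fun p => ¬ DefinedIn p P) (fun l hl => hQ l (List.mem_cons_of_mem _ hl))
    fun c hc hsym => (hext.not_defined_of_body hc (hsym ▸ hA)).2⟩
  obtain ⟨c, hc, c', σ, hvar, hdisj, hmgu, rfl⟩ := h.exists_clause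
  refine Resolvent.intro A B c c' σ (hext.not_defined_of_body hc ?_).1 hvar hdisj hmgu
  rwa [← hvar.head_sym, ← hmgu.sym_eq]

theorem Resolvent.mono {P P' : Program L} (hP : P ⊆ P') {Q Q' : Query L} (h : Resolvent P Q Q') :
    Resolvent P' Q Q' := by
  cases h with
  | intro A B c c' σ hc hvar hdisj hmgu => exact .intro A B c c' σ (hP hc) hvar hdisj hmgu

/-- Negation steps depend on the outcome of subsidiary trees, so transferring derivations to `R`
also requires transferring finite failure and, mutually with it, success. -/
theorem FinitelyFailed.of_union (hext : Extends P R) {Q : Query L}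
    (h : FinitelyFailed (P ∪ R) Q) (hQ : ∀ l ∈ Q, ¬ DefinedIn l.sym P) : FinitelyFailed R Q := by
  have single : ∀ {A : Atom L ℕ} {B : Query L},
      (∀ l ∈ Literal.neg A :: B, ¬ DefinedIn l.sym P) →
      ∀ l ∈ [Literal.pos A], ¬ DefinedIn l.sym P := by
    intro A B h l hl
    rw [List.mem_singleton.1 hl]
    exact h (Literal.neg A) List.mem_cons_self
  refine FinitelyFailed.rec
    (motive_1 := fun Q _ => (∀ l ∈ Q, ¬ DefinedIn l.sym P) → Successful R Q)
    (motive_2 := fun Q _ => (∀ l ∈ Q, ¬ DefinedIn l.sym P) → FinitelyFailed R Q)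
    ?_ ?_ ?_ ?_ ?_ ?_ h hQ
  · exact fun _ => Successful.nil
  · intro Q Q' hres _ ih hQ
    have := hres.of_union hext hQ
    exact .resolve Q Q' this.1 (ih this.2)
  · intro A B hA _ _ ih1 ih2 hQ
    exact .naf A B hA (ih1 (single hQ)) (ih2 fun l hl => hQ l (List.mem_cons_of_mem _ hl))
  · intro A B _ ih hQ
    refine .resolve A B fun Q' hres => ?_
    have hres' := hres.mono (Set.subset_union_right (s := P))
    exact ih Q' hres' (hres'.of_union hext hQ).2
  · intro A B hA _ ih hQ
    exact .negSuccess A B hA (ih (single hQ))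
  · intro A B hA _ _ ih1 ih2 hQ
    exact .negFail A B hA (ih1 (single hQ)) (ih2 fun l hl => hQ l (List.mem_cons_of_mem _ hl))

theorem acc_union_of_acc (hext : Extends P R) {Q : Query L} (h : Acc (Next R) Q)
    (hQ : ∀ l ∈ Q, ¬ DefinedIn l.sym P) : Acc (Next (P ∪ R)) Q := by
  induction h with
  | intro Q _ ih =>
  refine Acc.intro _ fun Q' hQ' => ?_
  rcases hQ' with hstep | hsub
  · cases hstep with
    | resolve _ _ hres =>
      have := hres.of_union hext hQ
      exact ih _ (Or.inl (.resolve _ _ this.1)) this.2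
    | naf A B hA hfail =>
      refine ih _ (Or.inl (.naf A _ hA (hfail.of_union hext ?_)))
        fun l hl => hQ l (List.mem_cons_of_mem _ hl)
      intro l hl
      rw [List.mem_singleton.1 hl]
      exact hQ (Literal.neg A) List.mem_cons_self
  · refine ih _ (Or.inr hsub) ?_
    cases hsub with
    | intro A B hA =>
      intro l hl
      rw [List.mem_singleton.1 hl]
      exact hQ (Literal.neg A) List.mem_cons_self

end Termination

/-! ### Termination of the extended program -/

section Extension

open FirstOrder.Language

variable {L : FirstOrder.Language.{u, v}} {D : Type w} {m : Moding L} {P R S : Program L}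
  {M : L.Structure D} {lev : LevelMapping L}

/-- All relations occurring in negative literals of `Q` are in `negStar S`. -/
def NegInStar (S : Program L) (Q : Query L) : Prop :=
  ∀ A, Literal.neg A ∈ Q → A.sym ∈ negStar S

theorem mem_negStar_of_neg_mem {c : Clause L ℕ} (hc : c ∈ S) {A : Atom L ℕ}
    (hA : Literal.neg A ∈ c.body) : A.sym ∈ negStar S :=
  ⟨A.sym, ⟨c, hc, A, hA, rfl⟩, Relation.ReflTransGen.refl⟩

theorem NegInStar.subst {Q : Query L} (h : NegInStar S Q) (σ : ℕ → L.Term ℕ) :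
    NegInStar S (Q.subst σ) := by
  intro A hA
  obtain ⟨l, hl, heq⟩ := List.mem_map.1 hA
  cases l with
  | pos A' => cases heq
  | neg A' =>
    cases heq
    exact h A' hl

theorem NegInStar.body {c c' : Clause L ℕ} (hc : c ∈ S) (hvar : c'.IsVariant c) :
    NegInStar S c'.body := by
  obtain ⟨ρ, rfl⟩ := hvar
  exact NegInStar.subst (Q := c.body) (fun A hA => mem_negStar_of_neg_mem hc hA) _

theorem NegInStar.append {Q Q' : Query L} (h : NegInStar S Q) (h' : NegInStar S Q') :
    NegInStar S (Q ++ Q') :=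
  fun A hA => (List.mem_append.1 hA).elim (h A) (h' A)

/-- In every ground instance of `Q₁, Q₂` in which `Q₁` is true, the level of every literal of
`Q₂` that is preceded in `Q₂` by true literals only is less than `k`. -/
def BoundedAfter (M : L.Structure D) (lev : LevelMapping L) (k : ℕ) (Q₁ Q₂ : Query L) : Prop :=
  ∀ τ : ℕ → L.Term Empty, (∀ l ∈ Q₁, (l.subst τ).Holds M Empty.elim) →
    ∀ (pre : Query L) (b : Literal L ℕ) (post : Query L), Q₂ = pre ++ b :: post →
      (∀ l ∈ pre, (l.subst τ).Holds M Empty.elim) → lev.ofLiteral (b.subst τ) < k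

theorem BoundedAfter.mono_left {k : ℕ} {Q₁ Q₁' Q₂ : Query L} (h : BoundedAfter M lev k Q₁ Q₂)
    (hQ : ∀ τ : ℕ → L.Term Empty, (∀ l ∈ Q₁', (l.subst τ).Holds M Empty.elim) →
      ∀ l ∈ Q₁, (l.subst τ).Holds M Empty.elim) : BoundedAfter M lev k Q₁' Q₂ :=
  fun τ hτ => h τ (hQ τ hτ)

theorem BoundedAfter.subst {k : ℕ} {Q₁ Q₂ : Query L} (h : BoundedAfter M lev k Q₁ Q₂)
    (σ : ℕ → L.Term ℕ) : BoundedAfter M lev k (Q₁.subst σ) (Q₂.subst σ) := by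
  intro τ hτ pre b post heq hpre
  obtain ⟨pre, post', rfl, rfl, heq'⟩ := List.map_eq_append_iff.1 heq
  obtain ⟨b, post, rfl, rfl, rfl⟩ := List.map_eq_cons_iff.1 heq'
  rw [Literal.subst_subst]
  refine h _ (fun l hl => ?_) pre b post rfl fun l hl => ?_
  · rw [← Literal.subst_subst]
    exact hτ _ (List.mem_map.2 ⟨l, hl, rfl⟩)
  · rw [← Literal.subst_subst]
    exact hpre _ (List.mem_map.2 ⟨l, hl, rfl⟩)

/-- If a ground instance of the resolvent is true, the clause makes the instance of its head true in
the model `M`, and this is the instance of `A`. So truth of the new query implies truth of the old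
one. -/
theorem BoundedAfter.resolve {k : ℕ} {A : Atom L ℕ} {B Q₂ : Query L}
    (h : BoundedAfter M lev k (Literal.pos A :: B) Q₂) (hM : IsModel M S) {c c' : Clause L ℕ}
    (hc : c ∈ S) (hvar : c'.IsVariant c) {σ : ℕ → L.Term ℕ} (hσ : A.subst σ = c'.head.subst σ) :
    BoundedAfter M lev k (Query.subst (c'.body ++ B) σ) (Q₂.subst σ) := by
  refine (h.subst σ).mono_left fun τ hτ l hl => ?_
  obtain ⟨l, hl', rfl⟩ := List.mem_map.1 hl
  have hτ' : ∀ l ∈ c'.body ++ B, ((l.subst σ).subst τ).Holds M Empty.elim :=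
    fun l hl => hτ _ (List.mem_map.2 ⟨l, hl, rfl⟩)
  rcases List.mem_cons.1 hl' with rfl | hl'
  · have := hvar.head_holds hM hc fun l hl =>
      Literal.holds_subst.1 (Literal.holds_subst.1 (hτ' l (List.mem_append_left _ hl)))
    rw [← Atom.holds_subst, ← hσ, ← Atom.holds_subst] at this
    exact this
  · exact hτ' l (List.mem_append_right _ hl')

/-- Finite failure makes every instance of `A` false in `M`, so the removed literal `¬A` was true
and the hypothesis on `Q₁` is not weakened. -/
theorem BoundedAfter.naf {k : ℕ} {A : Atom L ℕ} {B Q₂ : Query L}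
    (h : BoundedAfter M lev k (Literal.neg A :: B) Q₂) (hM : IsCompleteModel M S)
    (hA : A.sym ∈ negStar S) (hfail : FinitelyFailed S [Literal.pos A]) :
    BoundedAfter M lev k B Q₂ := by
  refine h.mono_left fun τ hτ l hl => ?_
  rcases List.mem_cons.1 hl with rfl | hl
  · refine Literal.holds_subst.2 fun hholds => hfail.not_holds hM ?_
      (fun x => termValue M Empty.elim (τ x)) ?_
    · intro l hl
      rw [List.mem_singleton.1 hl]
      exact hA
    · intro l hl
      rw [List.mem_singleton.1 hl]
      exact hholds
  · exact hτ l hl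

/-- A well-moded query of bounded level terminates if the well-moded literals of bounded level
do. -/
theorem acc_of_boundedAfter (hwm : WellModedProgram m S) (hM : IsCompleteModel M S) {k : ℕ}
    (hlit : ∀ l : Literal L ℕ, WellModedFrom m ∅ [l] → OccursIn l.sym P →
      (∀ τ : ℕ → L.Term Empty, lev.ofLiteral (l.subst τ) < k) → Acc (Next S) [l])
    (Q : Query L) (hQ : WellModedFrom m ∅ Q) (hneg : NegInStar S Q)
    (hocc : ∀ l ∈ Q, OccursIn l.sym P) (hbound : BoundedAfter M lev k [] Q) :
    Acc (Next S) Q := by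
  induction hn : Q.length using Nat.strong_induction_on generalizing Q with
  | _ n ih =>
  subst hn
  cases Q with
  | nil => exact acc_nil
  | cons l Q =>
  have hl : Acc (Next S) [l] := by
    refine hlit l ⟨hQ.1, trivial⟩ (hocc l List.mem_cons_self) fun τ => ?_
    exact hbound τ (by simp) [] l Q rfl (by simp)
  refine acc_append (fun Q₁ Q₂ => WellModedFrom m ∅ (Q₁ ++ Q₂) ∧ Q₂.length ≤ Q.length ∧
    NegInStar S (Q₁ ++ Q₂) ∧ (∀ l ∈ Q₂, OccursIn l.sym P) ∧ BoundedAfter M lev k Q₁ Q₂)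
    ?_ ?_ ?_ hl ⟨hQ, le_rfl, hneg, fun l hl => hocc l (List.mem_cons_of_mem _ hl), ?_⟩
  · rintro A B Q₂ c c' σ ⟨h1, h2, h3, h4, h5⟩ hc hvar hσ
    have heq : Query.subst (c'.body ++ B) σ ++ Query.subst Q₂ σ =
        Query.subst (c'.body ++ (B ++ Q₂)) σ := by
      simp only [Query.subst, List.map_append, List.append_assoc]
    refine ⟨?_, ?_, ?_, ?_, h5.resolve hM.1 hc hvar hσ⟩
    · rw [heq]
      exact WellModedFrom.resolve h1 ((hwm c hc).of_isVariant hvar) hσ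
    · rwa [Query.subst, List.length_map]
    · rw [heq]
      exact ((NegInStar.body hc hvar).append fun A' hA' =>
        h3 A' (List.mem_cons_of_mem _ hA')).subst σ
    · intro l hl
      obtain ⟨l, hl', rfl⟩ := List.mem_map.1 hl
      rw [Literal.sym_subst]
      exact h4 l hl'
  · rintro A B Q₂ ⟨h1, h2, h3, h4, h5⟩ hA hfail
    exact ⟨WellModedFrom.tail_of_isGround h1 hA, h2,
      fun A' hA' => h3 A' (List.mem_cons_of_mem _ hA'), h4,
      h5.naf hM (h3 A List.mem_cons_self) hfail⟩
  · rintro Q₂ ⟨h1, h2, h3, h4, h5⟩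
    exact ih Q₂.length (Nat.lt_succ_of_le h2) Q₂ h1 h3 h4 h5 rfl
  -- Initially `Q₁` is the first literal; moving it into the true prefix reduces the bound to the
  -- one for the whole query.
  · intro τ hτ pre b post heq hpre
    refine hbound τ (by simp) (l :: pre) b post (by rw [heq]; rfl) fun l' hl' => ?_
    rcases List.mem_cons.1 hl' with rfl | hl'
    · exact hτ _ List.mem_cons_self
    · exact hpre l' hl'

/-- The body of a clause of an acceptable program is bounded by the level of the head. -/
theorem Acceptable.boundedAfter_body (hacc : Acceptable P lev M) {c c' : Clause L ℕ} (hc : c ∈ P)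
    (hvar : c'.IsVariant c) {A : Atom L ℕ} {σ : ℕ → L.Term ℕ}
    (hσ : A.subst σ = c'.head.subst σ) {k : ℕ}
    (hA : ∀ τ : ℕ → L.Term Empty, lev (A.subst τ) < k + 1) :
    BoundedAfter M lev k [] (Query.subst c'.body σ) := by
  intro τ _ pre b post heq hpre
  have atom_subst : ∀ B : Atom L ℕ, (B.subst σ).subst τ = B.subst fun x => (σ x).subst τ := by
    intro B
    simp [Atom.subst, subst_subst]
  obtain ⟨ρ, rfl⟩ := hvar
  -- Renaming, unifier and grounding compose to one ground substitution of the program clause, to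
  -- which acceptability applies.
  have hhead : (c.subst fun x => (σ (ρ x)).subst τ).head =
      A.subst fun x => (σ x).subst τ := by
    rw [← atom_subst, hσ, atom_subst]
    simp [Clause.subst, Atom.subst, subst_subst, Term.subst]
  have hbody : (c.subst fun x => (σ (ρ x)).subst τ).body =
      pre.map (fun l => l.subst τ) ++ b.subst τ :: post.map fun l => l.subst τ := by
    have := congrArg (List.map fun l => l.subst τ) heq
    rw [List.map_append, List.map_cons] at this
    rw [← this]
    simp [Clause.subst, Query.subst, Literal.subst_subst, Term.subst, Function.comp_def]
  have := hacc _ ⟨c, hc, _, rfl⟩ _ _ _ hbody (by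
    intro l hl
    obtain ⟨l, hl', rfl⟩ := List.mem_map.1 hl
    exact hpre l hl')
  rw [hhead] at this
  exact lt_of_lt_of_le this (Nat.le_of_lt_succ (hA _))

/-- The bound is required for all ground instances, and acceptability passes it on in this uniform
form to each body literal once its predecessors are true. Negation costs nothing, since the
subsidiary query has the same level. -/
theorem acc_of_level_lt [Nonempty L.Constants] (hwm : WellModedProgram m (P ∪ R))
    (hext : Extends P R) (hM : IsCompleteModel M (P ∪ R)) (hacc : Acceptable P lev M)
    (hterm : ∀ Q : Query L, WellModedFrom m ∅ Q → Acc (Next R) Q) (k : ℕ) (l : Literal L ℕ)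
    (hl : WellModedFrom m ∅ [l]) (hocc : OccursIn l.sym P)
    (hlev : ∀ τ : ℕ → L.Term Empty, lev.ofLiteral (l.subst τ) < k) :
    Acc (Next (P ∪ R)) [l] := by
  induction k generalizing l with
  | zero =>
    obtain ⟨c⟩ := ‹Nonempty L.Constants›
    -- A constant provides a ground instance, whose level cannot be below `0`.
    exact absurd (hlev fun _ => Constants.term c) (Nat.not_lt_zero _)
  | succ k ih =>
  have hpos : ∀ A : Atom L ℕ, WellModedFrom m ∅ [Literal.pos A] → OccursIn A.sym P →
      (∀ τ : ℕ → L.Term Empty, lev (A.subst τ) < k + 1) →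
      Acc (Next (P ∪ R)) [Literal.pos A] := by
    intro A hA hoccA hlevA
    by_cases hdef : DefinedIn A.sym P
    · refine acc_of_resolvents fun Q' hres => ?_
      -- As `P` extends `R`, a relation defined in `P` has no clauses in `R`, so acceptability
      -- covers the clause used.
      have hclause : ∀ c ∈ P ∪ R, c.head.sym = A.sym → c ∈ P := fun c hc hsym =>
        hc.resolve_right fun hcR => hext _ hdef ⟨c, hcR, Or.inl hsym⟩
      have hoccQ' : ∀ l ∈ Q', OccursIn l.sym P :=
        hres.sym_induction (q := fun p => OccursIn p P) (by simp)
          fun c hc hsym l hl => ⟨c, hclause c hc hsym, Or.inr ⟨l, hl, rfl⟩⟩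
      obtain ⟨c, hc, c', σ, hvar, -, hmgu, rfl⟩ := hres.exists_clause
      have hcP := hclause c hc (hvar.head_sym.symm.trans hmgu.sym_eq.symm)
      refine acc_of_boundedAfter hwm hM ih _
        (hA.resolve ((hwm c hc).of_isVariant hvar) hmgu.1) ?_ hoccQ' ?_
      · rw [List.append_nil]
        exact (NegInStar.body hc hvar).subst σ
      · rw [List.append_nil]
        exact hacc.boundedAfter_body hcP hvar hmgu.1 hlevA
    · refine acc_union_of_acc hext (hterm _ hA) fun l hl => ?_
      rw [List.mem_singleton.1 hl]
      exact hdef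
  cases l with
  | pos A => exact hpos A hl hocc hlev
  | neg A => exact acc_neg (hpos A ⟨hl.1, trivial⟩ hocc hlev)

/-- A well-moded literal has the same level in all its ground instances. -/
theorem IsModedLevelMapping.ofLiteral_subst_eq (hlev : IsModedLevelMapping m P lev)
    {l : Literal L ℕ} (hl : WellModedFrom m ∅ [l]) (hocc : OccursIn l.sym P)
    (τ τ' : ℕ → L.Term Empty) : lev.ofLiteral (l.subst τ) = lev.ofLiteral (l.subst τ') := by
  simp only [LevelMapping.ofLiteral, Literal.atom_subst]
  refine hlev _ _ _ _ hocc fun i hi => subst_congr _ fun x hx => ?_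
  exact (hl.1 ⟨i, hi, hx⟩).elim

end Extension

end LogicProg

theorem corollary1 {L : FirstOrder.Language.{u, v}} [Nonempty L.Constants]
    (P R : LogicProg.Program L) (hPfin : P.Finite) (hRfin : R.Finite)
    (m : LogicProg.Moding L) (hwm : LogicProg.WellModedProgram m (P ∪ R))
    (hext : LogicProg.Extends P R)
    {D : Type w} (M : L.Structure D) (hM : LogicProg.IsCompleteModel M (P ∪ R))
    (lev : LogicProg.LevelMapping L) (hlev : LogicProg.IsModedLevelMapping m P lev)
    (hacc : LogicProg.Acceptable P lev M)
    (hterm : ∀ Q : LogicProg.Query L, LogicProg.WellModedQuery m Q →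
      LogicProg.AllDerivationsFinite R Q) :
    ∀ Q : LogicProg.Query L, LogicProg.WellModedQuery m Q →
      LogicProg.AllDerivationsFinite (P ∪ R) Q := by
  classical
  have hR : ∀ Q : LogicProg.Query L, LogicProg.WellModedFrom m ∅ Q →
      Acc (LogicProg.Next R) Q := fun Q hQ =>
    LogicProg.allDerivationsFinite_iff_acc.1 (hterm Q (LogicProg.wellModedQuery_iff.2 hQ))
  have hlit : ∀ l : LogicProg.Literal L ℕ, LogicProg.WellModedFrom m ∅ [l] →
      Acc (LogicProg.Next (P ∪ R)) [l] := by
    intro l hl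
    by_cases hocc : LogicProg.OccursIn l.sym P
    · obtain ⟨c⟩ := ‹Nonempty L.Constants›
      refine LogicProg.acc_of_level_lt (hwm := hwm) (hext := hext) (hM := hM) (hacc := hacc)
        (hterm := hR)
        -- Any ground instance serves to read off the level, since all have the same one; `+ 1`
        -- makes the bound strict.
        (lev.ofLiteral (l.subst fun _ => FirstOrder.Language.Constants.term c) + 1) l hl hocc
        fun τ => ?_
      rw [hlev.ofLiteral_subst_eq hl hocc τ]
      exact Nat.lt_succ_self _
    · refine LogicProg.acc_union_of_acc hext (hR _ hl) fun l' hl' => ?_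
      rw [List.mem_singleton.1 hl']
      rintro ⟨c, hc, hsym⟩
      exact hocc ⟨c, hc, Or.inl hsym⟩
  intro Q hQ
  rw [LogicProg.allDerivationsFinite_iff_acc]
  rw [LogicProg.wellModedQuery_iff] at hQ
  induction hn : Q.length using Nat.strong_induction_on generalizing Q with
  | _ n ih =>
  subst hn
  cases Q with
  | nil => exact LogicProg.acc_nil
  | cons l Q =>
  -- No level bound is needed here: every well-moded literal is already known to terminate, and the
  -- length of the remaining query drives the induction.
  refine LogicProg.acc_append (fun Q₁ Q₂ => LogicProg.WellModedFrom m ∅ (Q₁ ++ Q₂) ∧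
    Q₂.length ≤ Q.length) ?_ ?_ ?_ (hlit l ⟨hQ.1, trivial⟩) ⟨hQ, le_rfl⟩
  · rintro A B Q₂ c c' σ ⟨h1, h2⟩ hc hvar hσ
    have heq : LogicProg.Query.subst (c'.body ++ B) σ ++ LogicProg.Query.subst Q₂ σ =
        LogicProg.Query.subst (c'.body ++ (B ++ Q₂)) σ := by
      simp only [LogicProg.Query.subst, List.map_append, List.append_assoc]
    refine ⟨?_, by rwa [LogicProg.Query.subst, List.length_map]⟩
    rw [heq]
    exact LogicProg.WellModedFrom.resolve h1 ((hwm c hc).of_isVariant hvar) hσ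
  · rintro A B Q₂ ⟨h1, h2⟩ hA _
    exact ⟨LogicProg.WellModedFrom.tail_of_isGround h1 hA, h2⟩
  · rintro Q₂ ⟨h1, h2⟩
    exact ih Q₂.length (Nat.lt_succ_of_le h2) Q₂ h1 rfl
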